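/- Let $\Gamma$ be a group, $\Gamma'=\{\Gamma_i\}_{i\in I}$ a finite non-empty family of subgroups (repetitions allowed), and $S\not\ni 1$ a finite symmetric generating set of $\Gamma$ such that $S\cap\Gamma_i$ generates $\Gamma_i$ for every $i\in I$. The combinatorial horoball on a graph $G$ has vertex set $G^{(0)}\times\mathbb N$; its edges join $(g,n)$ to $(g,n+1)$, and join $(g,n)$ to $(h,n)$ whenever $g\ne h$ and $d_G(g,h)\le 2^n$. The cusped graph $X$ of $(\Gamma,\Gamma')$ with respect to $S$ is obtained from the simplicial Cayley graph of $\Gamma$ (in which $g\neq h$ are adjacent iff $g^{-1}h\in S$) by gluing, for every $i\in I$ and every left coset $g\Gamma_i$, the combinatorial horoball on the full subgraph with vertex set $g\Gamma_i$ along its level $0$. For $n\in\mathbb N$, an $n$-horoball of $X$ is the full subgraph of $X$ spanned by the vertices of height (second coordinate) at least $n$ in one of the horoballs. Assume that the pair is relatively hyperbolic, i.e. that $X$ with its graph metric is Gromov hyperbolic, and let the integer $\delta\ge 0$ be a hyperbolicity constant of $X$, i.e. geodesic triangles of $X$ are $\delta$-slim. (It is enough to require that, for every geodesic triangle whose corners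 are vertices of $X$, every vertex on one side is at distance at most $\delta$ from a vertex on the union of the other two sides.) Let $C>\delta$ and $\kappa\ge 4\delta+6$ be integers, and let $\mathscr R=\mathscr R_\kappa(X)$ be the Rips complex: the simplicial complex whose simplices are the non-empty finite sets of vertices of $X$ of diameter at most $\kappa$ in $X$. Then (geometric realizations carrying the weak topology): 1. $\mathscr R$ is contractible; 2. every $C$-horoball of $\mathscr R$, i.e. the full subcomplex of $\mathscr R$ spanned by the vertices of a $C$-horoball of $X$, is contractible; 3. every ball of $\mathscr R$, i.e. for a vertex $v$ and $r\in\mathbb N$ the full subcomplex of $\mathscr R$ spanned by the vertices at distance at most $r$ from $v$ in the $1$-skeleton of $\mathscr R$, is contractible. -/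

import Mathlib

universe u v

/-! ### Simplicial complexes, their geometric realization, full subcomplexes, Rips complexes -/

/-- The set of points of the geometric realization of an abstract simplicial complex `K`, in
barycentric coordinates: finitely supported functions `x ≥ 0` on the vertices with total mass `1`
whose support is a simplex of `K`. -/
def SCRealization {V : Type u} (K : PreAbstractSimplicialComplex V) : Type u :=
  {x : V →₀ ℝ // x.support ∈ K.faces ∧ (∀ v, 0 ≤ x v) ∧ (x.sum fun _ t => t) = 1}

/-- The closed simplex of the realization spanned by the finite vertex set `s`. -/
def SCRealization.closedSimplex {V : Type u} (K : PreAbstractSimplicialComplex V) (s : Finset V) :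
    Set (SCRealization K) :=
  {x | x.1.support ⊆ s}

/-- The usual Euclidean topology of a closed simplex: convergence of the (finitely many)
barycentric coordinates. -/
@[reducible] def SCRealization.simplexTopology {V : Type u} (K : PreAbstractSimplicialComplex V)
    (s : Finset V) : TopologicalSpace (SCRealization.closedSimplex K s) :=
  TopologicalSpace.induced (fun x (v : V) => x.1.1 v) Pi.topologicalSpace

/-- The weak (CW) topology on the realization: a set is open iff its trace on every
closed simplex of `K` is open. -/
instance SCRealization.instTopologicalSpace {V : Type u} (K : PreAbstractSimplicialComplex V) :
    TopologicalSpace (SCRealization K) :=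
  ⨆ s : K.faces, TopologicalSpace.coinduced
    (Subtype.val : SCRealization.closedSimplex K s.1 → SCRealization K)
    (SCRealization.simplexTopology K s.1)

/-- The full subcomplex of `K` spanned by a set `A` of vertices. -/
def fullSubcomplex {V : Type u} (K : PreAbstractSimplicialComplex V) (A : Set V) :
    PreAbstractSimplicialComplex V where
  faces := {s | s ∈ K.faces ∧ (s : Set V) ⊆ A}
  isRelLowerSet_faces := fun _ hs =>
    ⟨(K.isRelLowerSet_faces hs.1).1, fun _ hts ht =>
      ⟨(K.isRelLowerSet_faces hs.1).2 hts ht, fun _ hv => hs.2 (hts hv)⟩⟩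

/-- The `1`-skeleton of a simplicial complex, as a simplicial graph. -/
def oneSkeleton {V : Type u} (K : PreAbstractSimplicialComplex V) : SimpleGraph V :=
  SimpleGraph.fromRel fun a b => ∃ s ∈ K.faces, a ∈ s ∧ b ∈ s

/-- The ball of radius `r` centred at the vertex `v` in a simplicial complex `K`: the full
subcomplex spanned by the vertices at distance at most `r` from `v` in the `1`-skeleton of `K`. -/
def complexBall {V : Type u} (K : PreAbstractSimplicialComplex V) (v : V) (r : ℕ) :
    PreAbstractSimplicialComplex V :=
  fullSubcomplex K {w | (oneSkeleton K).edist v w ≤ (r : ℕ∞)}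

/-- The Rips complex of a graph: the simplices are the nonempty finite sets of vertices
of diameter at most `κ` for the graph metric. -/
def ripsComplex {V : Type u} (G : SimpleGraph V) (κ : ℕ) : PreAbstractSimplicialComplex V where
  faces := {s | s.Nonempty ∧ ∀ a ∈ s, ∀ b ∈ s, G.edist a b ≤ (κ : ℕ∞)}
  isRelLowerSet_faces := fun _ hs =>
    ⟨hs.1, fun _ hts ht => ⟨ht, fun a ha b hb => hs.2 a (hts ha) b (hts hb)⟩⟩

/-! ### Hyperbolic graphs -/

/-- `δ`-hyperbolicity of a graph for an integer `δ`: geodesic triangles are `δ`-slim.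

Triangles have vertices of the graph as corners, and slimness is checked at the vertices on the
sides. If all geodesic triangles of the metric graph (edges of length `1`) are `δ`-slim with `δ`
an integer, then this condition holds: when a vertex `a` is within the integer distance `δ` of an
interior point of an edge, it is within `δ` of an endpoint of this edge. -/
def IsHyperbolicGraph {V : Type u} (G : SimpleGraph V) (δ : ℕ) : Prop :=
  ∀ (x y z : V) (p : G.Walk x y) (q : G.Walk y z) (r : G.Walk x z),
    p.length = G.dist x y → q.length = G.dist y z → r.length = G.dist x z →
    ∀ a ∈ p.support, ∃ b, (b ∈ q.support ∨ b ∈ r.support) ∧ G.edist a b ≤ (δ : ℕ∞)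

/-! ### Horoballs and the cusped graph of a group-pair -/

/-- The combinatorial horoball on a graph `G`. Vertices: `V × ℕ`. Edges: between `(g, n)` and
`(g, n + 1)`, and between `(g, n)` and `(h, n)` when `g ≠ h` and `d_G(g, h) ≤ 2 ^ n`.
(For `n = 0` the latter are exactly the edges of `G`.) -/
def combinatorialHoroball {V : Type u} (G : SimpleGraph V) : SimpleGraph (V × ℕ) :=
  SimpleGraph.fromRel fun a b =>
    (a.1 = b.1 ∧ b.2 = a.2 + 1) ∨ (a.2 = b.2 ∧ G.edist a.1 b.1 ≤ ((2 ^ a.2 : ℕ) : ℕ∞))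

/-- `S` is a finite symmetric generating set of `Γ` not containing `1`, which is compatible with
the family `P` of subgroups: `S ∩ P i` generates `P i` for every `i`. -/
structure IsCompatibleGeneratingSet {Γ : Type u} [Group Γ] {I : Type v} (P : I → Subgroup Γ)
    (S : Set Γ) : Prop where
  finite : S.Finite
  one_notMem : (1 : Γ) ∉ S
  inv_mem : ∀ s ∈ S, s⁻¹ ∈ S
  closure_eq_top : Subgroup.closure S = ⊤
  closure_inter : ∀ i, Subgroup.closure (S ∩ (P i : Set Γ)) = P i

/-- Vertices of the cusped graph: the elements of `Γ` (height `0`), and the triples `(g, i, n + 1)`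
of positive height `n + 1` in the horoball over the coset `g Γ_i`. -/
inductive CuspedVertex (Γ : Type u) (I : Type v) : Type (max u v)
  | base (g : Γ) : CuspedVertex Γ I
  | deep (g : Γ) (i : I) (n : ℕ) : CuspedVertex Γ I

/-- The vertex denoted by the triple `(g, i, n)`; all the triples `(g, i, 0)` with `i` varying
denote the same vertex. -/
def CuspedVertex.triple {Γ : Type u} {I : Type v} (g : Γ) (i : I) : ℕ → CuspedVertex Γ I
  | 0 => CuspedVertex.base g
  | n + 1 => CuspedVertex.deep g i n

/-- The left coset `g H`. -/
def leftCosetSet {Γ : Type u} [Group Γ] (H : Subgroup Γ) (g : Γ) : Set Γ :=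
  {h | g⁻¹ * h ∈ H}

/-- The cusped graph: the (simplicial) Cayley graph of `Γ` together with, for each `i` and each
left coset `g Γ_i`, the horoball on the full subgraph of the Cayley graph with vertex set `g Γ_i`,
glued along its level `0`. -/
def cuspedGraph {Γ : Type u} [Group Γ] {I : Type v} (P : I → Subgroup Γ) (S : Set Γ) :
    SimpleGraph (CuspedVertex Γ I) :=
  (SimpleGraph.mulCayley S).map CuspedVertex.base ⊔
    ⨆ (i : I) (g : Γ),
      (combinatorialHoroball ((SimpleGraph.mulCayley S).induce (leftCosetSet (P i) g))).map
        fun a => CuspedVertex.triple a.1.1 i a.2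

/-- The vertex set of the `n`-horoball over the coset `g Γ_i`: the vertices of height at least `n`
in the horoball over `g Γ_i`. -/
def horoballVertices {Γ : Type u} [Group Γ] {I : Type v} (P : I → Subgroup Γ) (i : I) (g : Γ)
    (n : ℕ) : Set (CuspedVertex Γ I) :=
  {x | ∃ h ∈ leftCosetSet (P i) g, ∃ m : ℕ, n ≤ m ∧ x = CuspedVertex.triple h i m}

/-! ### Continuity with respect to the weak topology -/

/-! Each of the three complexes is the full subcomplex of the Rips complex on a vertex set `A` that
contains, with each vertex, a geodesic to it from a fixed `o ∈ A`. Such a subcomplex is contractible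
(`contractibleSpace_ripsComplex_of_starShaped`): move `v` back by `κ / 2` along its geodesic, or to
`o` if `o` is nearer. Slimness and `4 * δ ≤ κ` keep the new vertex within `κ` of every `w` that was
within `κ` of `v` and is no farther from `o` than `v` (`IsHyperbolicGraph.dist_le_of_geodesic`).
Repeating this until the distance to `o` is at most `n` gives vertex maps `r n`; consecutive ones
are contiguous (`shrink_rel`), `r 0` is constant on `A`, and each vertex is fixed by `r n` for large
`n`. Straight-line homotopies between `r (n + 1)` and `r n`, run during `[1 / (n + 2), 1 / (n +
1)]`, form a contraction; it is continuous because only finitely many of them move a given closed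
simplex (`SCRealization.contractibleSpace_of_contiguous`).

A ball of the Rips complex is spanned by a ball of the graph, of radius multiplied by `κ`, which is
star-shaped about its centre. For a horoball of depth `C > δ`, compare a geodesic between two of its
vertices with two almost vertical geodesics to a very high vertex: slimness keeps it inside the
horoball at positive height. Pushing it up to height `C` does not lengthen it, so a geodesic inside
the `C`-horoball results (`exists_geodesic_in_horoball`). -/

namespace SCRealization

/-- A closed simplex, with its Euclidean topology. -/
def ClosedSimplex {V : Type u} (K : PreAbstractSimplicialComplex V) (s : Finset V) : Type u :=
  closedSimplex K s

instance {V : Type u} (K : PreAbstractSimplicialComplex V) (s : Finset V) :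
    TopologicalSpace (ClosedSimplex K s) :=
  simplexTopology K s

/-- The inclusion of a closed simplex. -/
def ClosedSimplex.incl {V : Type u} (K : PreAbstractSimplicialComplex V) (s : Finset V)
    (x : ClosedSimplex K s) : SCRealization K :=
  Subtype.val x

variable {V : Type u} {K : PreAbstractSimplicialComplex V}

theorem ClosedSimplex.continuous_coord (s : Finset V) (v : V) :
    Continuous fun x : ClosedSimplex K s => (ClosedSimplex.incl K s x).1 v :=
  (continuous_apply v).comp
    (continuous_induced_dom (f := fun (x : closedSimplex K s) (v : V) => x.1.1 v))

theorem ClosedSimplex.continuous_mk {Y : Type*} [TopologicalSpace Y] {s : Finset V}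
    (F : Y → ClosedSimplex K s)
    (hF : ∀ v, Continuous fun y => (ClosedSimplex.incl K s (F y)).1 v) : Continuous F :=
  continuous_induced_rng.2 (continuous_pi hF)

theorem continuous_iff {Z : Type*} [TopologicalSpace Z] (F : SCRealization K → Z) :
    Continuous F ↔ ∀ s ∈ K.faces, Continuous (F ∘ ClosedSimplex.incl K s) := by
  constructor
  · intro h s hs
    have h1 := continuous_iSup_dom.1 h ⟨s, hs⟩
    exact continuous_coinduced_dom.1 h1
  · intro h
    refine continuous_iSup_dom.2 fun s => ?_
    exact continuous_coinduced_dom.2 (h s.1 s.2)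

theorem ClosedSimplex.continuous_incl {s : Finset V} (hs : s ∈ K.faces) :
    Continuous (ClosedSimplex.incl K s) :=
  (continuous_iff id).1 continuous_id s hs

/-- The set `T` need not be a simplex. Its finitely many subsets that are simplices give closed
simplices covering the image, so the preimage of a closed set is a finite union of closed pieces. -/
theorem continuous_of_finite {Y : Type*} [TopologicalSpace Y] (F : Y → SCRealization K)
    (T : Finset V) (hT : ∀ y, (F y).1.support ⊆ T)
    (hF : ∀ v, Continuous fun y => (F y).1 v) : Continuous F := by
  classical
  rw [continuous_iff_isClosed]
  intro Z hZ
  have hclosed : ∀ s : Finset V, IsClosed {y | (F y).1.support ⊆ s} := by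
    intro s
    have : {y | (F y).1.support ⊆ s} = ⋂ (v : V) (_ : v ∉ s), {y | (F y).1 v = 0} := by
      ext y
      simp only [Set.mem_ofPred_eq, Set.mem_iInter]
      constructor
      · intro h v hv
        by_contra h0
        exact hv (h (Finsupp.mem_support_iff.2 h0))
      · intro h v hv
        by_contra h0
        exact Finsupp.mem_support_iff.1 hv (h v h0)
    rw [this]
    exact isClosed_iInter fun v => isClosed_iInter fun _ => isClosed_singleton.preimage (hF v)
  have hpiece : ∀ s ∈ K.faces, IsClosed (F ⁻¹' Z ∩ {y | (F y).1.support ⊆ s}) := by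
    intro s hs
    let F' : {y | (F y).1.support ⊆ s} → ClosedSimplex K s := fun y => ⟨F y.1, y.2⟩
    have hF' : Continuous F' :=
      ClosedSimplex.continuous_mk F' fun v => (hF v).comp continuous_subtype_val
    have h1 : IsClosed ((ClosedSimplex.incl K s ∘ F') ⁻¹' Z) :=
      hZ.preimage ((ClosedSimplex.continuous_incl hs).comp hF')
    have h2 := (hclosed s).isClosedEmbedding_subtypeVal.isClosedMap _ h1
    convert h2 using 1
    ext y
    constructor
    · rintro ⟨hy, hy'⟩
      exact ⟨⟨y, hy'⟩, hy, rfl⟩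
    · rintro ⟨⟨y', hy'⟩, hy, rfl⟩
      exact ⟨hy, hy'⟩
  have hunion : F ⁻¹' Z = ⋃ s ∈ {s ∈ T.powerset | s ∈ K.faces},
      (F ⁻¹' Z ∩ {y | (F y).1.support ⊆ s}) := by
    ext y
    simp only [Set.mem_iUnion, Finset.mem_filter, Finset.mem_powerset, exists_prop]
    constructor
    · intro hy
      exact ⟨(F y).1.support, ⟨hT y, (F y).2.1⟩, hy, Finset.Subset.refl _⟩
    · rintro ⟨s, -, hy, -⟩
      exact hy
  rw [hunion]
  exact isClosed_biUnion_finset fun s hs => hpiece s (Finset.mem_filter.1 hs).2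

/-- A family of maps from the realization is jointly continuous if it is so on every closed
simplex. -/
theorem continuous_prod_of_closedSimplex {Y Z : Type*} [TopologicalSpace Y]
    [LocallyCompactSpace Y] [TopologicalSpace Z] (F : SCRealization K × Y → Z)
    (hF : ∀ s ∈ K.faces,
      Continuous fun p : ClosedSimplex K s × Y => F (ClosedSimplex.incl K s p.1, p.2)) :
    Continuous F := by
  have hfix : ∀ x : SCRealization K, Continuous fun y => F (x, y) := by
    intro x
    let x' : ClosedSimplex K x.1.support := ⟨x, Finset.Subset.refl _⟩
    exact (hF x.1.support x.2.1).comp (Continuous.prodMk_right x')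
  -- After currying, continuity in the first variable can be tested simplex by simplex; local
  -- compactness of `Y` permits uncurrying.
  let Φ : SCRealization K → C(Y, Z) := fun x => ⟨fun y => F (x, y), hfix x⟩
  have hΦ : Continuous Φ := by
    rw [continuous_iff]
    intro s hs
    exact (ContinuousMap.curry ⟨_, hF s hs⟩).continuous
  exact ContinuousMap.continuous_uncurry_of_continuous ⟨Φ, hΦ⟩

/-! ### Contracting a complex along a sequence of contiguous vertex maps -/

section Combination

variable (x : SCRealization K) (a b : V → V) (c : ℝ)

/-- The convex combination of the images of a point under two vertex maps. -/
noncomputable def combination : V →₀ ℝ :=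
  c • Finsupp.mapDomain a x.1 + (1 - c) • Finsupp.mapDomain b x.1

theorem sum_eq_linearCombination (y : V →₀ ℝ) :
    (y.sum fun _ t => t) = Finsupp.linearCombination ℝ (fun _ : V => (1 : ℝ)) y := by
  simp [Finsupp.linearCombination_apply]

theorem combination_sum : ((combination x a b c).sum fun _ t => t) = 1 := by
  have hx := x.2.2.2
  rw [sum_eq_linearCombination] at hx ⊢
  rw [combination, map_add, map_smul, map_smul, Finsupp.linearCombination_mapDomain,
    Finsupp.linearCombination_mapDomain]
  have h : ∀ f : V → V, (fun _ : V => (1 : ℝ)) ∘ f = fun _ => 1 := fun _ => rfl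
  rw [h, h, hx]
  simp

theorem mapDomain_nonneg {y : V →₀ ℝ} (hy : ∀ v, 0 ≤ y v) (v : V) :
    0 ≤ Finsupp.mapDomain a y v := by
  classical
  rw [Finsupp.mapDomain, Finsupp.sum_apply]
  refine Finset.sum_nonneg fun w _ => ?_
  simp only [Finsupp.single_apply]
  split_ifs
  · exact hy w
  · exact le_rfl

theorem combination_mem (hc : 0 ≤ c) (hc' : c ≤ 1) [DecidableEq V]
    (hK : ∀ s ∈ K.faces, s.image a ∪ s.image b ∈ K.faces) :
    (combination x a b c).support ∈ K.faces ∧ (∀ v, 0 ≤ combination x a b c v) ∧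
      ((combination x a b c).sum fun _ t => t) = 1 := by
  have hs := combination_sum x a b c
  refine ⟨?_, fun v => ?_, hs⟩
  · refine (K.isRelLowerSet_faces (hK _ x.2.1)).2 ?_ ?_
    · refine Finsupp.support_add.trans (Finset.union_subset_union ?_ ?_) <;>
        exact Finsupp.support_smul.trans Finsupp.mapDomain_support
    · rw [Finset.nonempty_iff_ne_empty]
      intro h0
      rw [Finsupp.support_eq_empty.1 h0] at hs
      simp at hs
  · have h1 : (0 : ℝ) ≤ 1 - c := by linarith
    exact add_nonneg (mul_nonneg hc (mapDomain_nonneg a x.2.2.1 v))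
      (mul_nonneg h1 (mapDomain_nonneg b x.2.2.1 v))

end Combination

/-- A continuous function of `t` which is `0` for `t ≤ 1 / (n + 2)` and `1` for
`1 / (n + 1) ≤ t`. -/
noncomputable def cutoff (n : ℕ) (t : ℝ) : ℝ :=
  max 0 (min 1 ((n + 1) * ((n + 2) * t - 1)))

theorem continuous_cutoff (n : ℕ) : Continuous (cutoff n) := by
  unfold cutoff
  fun_prop

theorem cutoff_nonneg (n : ℕ) (t : ℝ) : 0 ≤ cutoff n t := le_max_left _ _

theorem cutoff_le_one (n : ℕ) (t : ℝ) : cutoff n t ≤ 1 :=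
  max_le zero_le_one (min_le_left _ _)

theorem cutoff_eq_zero {n : ℕ} {t : ℝ} (h : (n + 2) * t ≤ 1) : cutoff n t = 0 := by
  refine max_eq_left ((min_le_right _ _).trans ?_)
  exact mul_nonpos_of_nonneg_of_nonpos (by positivity) (by linarith)

theorem cutoff_eq_one {n : ℕ} {t : ℝ} (h : 1 ≤ (n + 1) * t) : cutoff n t = 1 := by
  have hn : (0 : ℝ) < n + 1 := by positivity
  -- Multiplying the hypothesis by `n + 2` gives `(n + 1) * (n + 2) * t ≥ n + 2`.
  have ht : 1 ≤ (n + 1) * ((n + 2) * t - 1) := by nlinarith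
  rw [cutoff, min_eq_left ht, max_eq_right zero_le_one]

/-- With every `χ m` beyond `n` equal to `1`, the tail telescopes from `f N` down to `f (n + 1)`,
and the terms before `n` vanish. If `N ≤ n`, both sides are `f N`. -/
theorem telescope_eq {M : Type*} [AddCommGroup M] [Module ℝ M] (f : ℕ → M) (χ : ℕ → ℝ) (n N : ℕ)
    (hf : ∀ m, N ≤ m → f m = f N) (h0 : ∀ m < n, χ m = 0) (h1 : ∀ m, n < m → χ m = 1) :
    f N + ∑ m ∈ Finset.range N, χ m • (f m - f (m + 1)) = χ n • f n + (1 - χ n) • f (n + 1) := by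
  rcases le_or_gt N n with h | h
  · rw [Finset.sum_eq_zero, hf n h, hf (n + 1) (by omega)]
    · module
    · intro m hm
      rw [h0 m (by have := Finset.mem_range.1 hm; omega), zero_smul]
  · obtain ⟨k, rfl⟩ := Nat.exists_eq_add_of_le (Nat.succ_le_of_lt h)
    clear hf h
    induction k with
    | zero =>
      rw [Nat.add_zero, Finset.sum_range_succ, Finset.sum_eq_zero]
      · module
      · intro m hm
        rw [h0 m (Finset.mem_range.1 hm), zero_smul]
    | succ k ih =>
      rw [← ih, ← Nat.add_assoc, Finset.sum_range_succ, h1 (n.succ + k) (by omega)]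
      module

/-- The path from `v` to `r 0 v` through the vertices `r n v`. -/
noncomputable def vertexPath (r : ℕ → V → V) (N : V → ℕ) (t : ℝ) (v : V) : V →₀ ℝ :=
  Finsupp.single v 1 + ∑ n ∈ Finset.range (N v),
    cutoff n t • (Finsupp.single (r n v) 1 - Finsupp.single (r (n + 1) v) 1)

theorem continuous_vertexPath (r : ℕ → V → V) (N : V → ℕ) (v w : V) :
    Continuous fun t : ℝ => vertexPath r N t v w := by
  simp only [vertexPath, Finsupp.add_apply, Finsupp.finsetSum_apply, Finsupp.smul_apply,
    smul_eq_mul]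
  refine continuous_const.add (continuous_finsetSum _ fun n _ => ?_)
  exact (continuous_cutoff n).mul continuous_const

theorem vertexPath_apply_eq_zero (r : ℕ → V → V) (N : V → ℕ) (hN : ∀ v n, N v ≤ n → r n v = v)
    (t : ℝ) (v w : V) (hw : ∀ n ≤ N v, r n v ≠ w) : vertexPath r N t v w = 0 := by
  classical
  have hv : v ≠ w := by
    have := hw (N v) le_rfl
    rwa [hN v _ le_rfl] at this
  simp only [vertexPath, Finsupp.add_apply, Finsupp.finsetSum_apply, Finsupp.smul_apply,
    smul_eq_mul, Finsupp.sub_apply, Finsupp.single_apply, if_neg hv, zero_add]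
  refine Finset.sum_eq_zero fun n hn => ?_
  have hn' := Finset.mem_range.1 hn
  rw [if_neg (hw n hn'.le), if_neg (hw (n + 1) hn')]
  simp

theorem vertexPath_zero (r : ℕ → V → V) (N : V → ℕ) (v : V) :
    vertexPath r N 0 v = Finsupp.single v 1 := by
  rw [vertexPath, Finset.sum_eq_zero, add_zero]
  intro n _
  rw [cutoff_eq_zero (by simp), zero_smul]

/-- The index `n` depends on `t` only. At a given time all vertices of a simplex are therefore moved
by the same two vertex maps, and contiguity applies. -/
theorem exists_vertexPath_eq (r : ℕ → V → V) (N : V → ℕ) (hN : ∀ v n, N v ≤ n → r n v = v)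
    {t : ℝ} (ht : 0 < t) (ht' : t ≤ 1) :
    ∃ n : ℕ, ∀ v, vertexPath r N t v =
      cutoff n t • Finsupp.single (r n v) 1 + (1 - cutoff n t) • Finsupp.single (r (n + 1) v) 1 := by
  have h1 : 1 ≤ 1 / t := by rw [le_div_iff₀ ht]; linarith
  -- The choice `n = ⌊1 / t⌋ - 1` places `t` in `[1 / (n + 2), 1 / (n + 1)]`.
  obtain ⟨n, hn⟩ := Nat.exists_eq_add_of_le (Nat.le_floor (by exact_mod_cast h1) : 1 ≤ ⌊1 / t⌋₊)
  have hle : ((n : ℝ) + 1) * t ≤ 1 := by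
    have := Nat.floor_le (zero_le_one.trans h1)
    rw [hn, le_div_iff₀ ht] at this
    push_cast at this
    linarith
  have hlt : 1 ≤ ((n : ℝ) + 2) * t := by
    have := Nat.lt_floor_add_one (1 / t)
    rw [hn, div_lt_iff₀ ht] at this
    push_cast at this
    linarith
  refine ⟨n, fun v => ?_⟩
  rw [← telescope_eq (fun m => Finsupp.single (r m v) (1 : ℝ)) (fun m => cutoff m t) n (N v)]
  · simp only [hN v _ le_rfl, vertexPath]
  · intro m hm
    simp only [hN v _ le_rfl, hN v _ hm]
  · intro m hm
    refine cutoff_eq_zero (le_trans ?_ hle)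
    have : (m : ℝ) + 1 ≤ n := by exact_mod_cast hm
    exact mul_le_mul_of_nonneg_right (by linarith) ht.le
  · intro m hm
    refine cutoff_eq_one (hlt.trans ?_)
    have : (n : ℝ) + 1 ≤ m := by exact_mod_cast hm
    exact mul_le_mul_of_nonneg_right (by linarith) ht.le

theorem sum_smul_eq_combination (x : SCRealization K) (a b : V → V) (c : ℝ) :
    (x.1.sum fun v w => w • (c • Finsupp.single (a v) 1 + (1 - c) • Finsupp.single (b v) 1)) =
      combination x a b c := by
  simp only [combination, Finsupp.mapDomain, Finsupp.sum, Finset.smul_sum,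
    ← Finset.sum_add_distrib]
  refine Finset.sum_congr rfl fun v _ => ?_
  simp only [smul_add, Finsupp.smul_single, smul_eq_mul, mul_one, one_mul, mul_comm]

/-- A complex is contractible if it can be shrunk to a vertex through a sequence of contiguous
vertex maps which is eventually stationary at every vertex. -/
theorem contractibleSpace_of_contiguous [DecidableEq V] (r : ℕ → V → V) (N : V → ℕ) (v₀ : V)
    (hv₀ : {v₀} ∈ K.faces) (hN : ∀ v n, N v ≤ n → r n v = v)
    (hr₀ : ∀ s ∈ K.faces, ∀ v ∈ s, r 0 v = v₀)
    (hK : ∀ s ∈ K.faces, ∀ n, s.image (r n) ∪ s.image (r (n + 1)) ∈ K.faces) :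
    ContractibleSpace (SCRealization K) := by
  have hmem : ∀ (x : SCRealization K) (t : unitInterval),
      let y := x.1.sum fun v w => w • vertexPath r N (t : ℝ) v
      y.support ∈ K.faces ∧ (∀ v, 0 ≤ y v) ∧ (y.sum fun _ t => t) = 1 := by
    intro x t
    rcases eq_or_lt_of_le t.2.1 with h | h
    · have := combination_mem x id id 1 zero_le_one le_rfl (by simp)
      rw [← sum_smul_eq_combination] at this
      simp only [← h, vertexPath_zero]
      simpa using this
    · obtain ⟨n, hn⟩ := exists_vertexPath_eq r N hN h t.2.2
      simp only [hn, sum_smul_eq_combination]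
      exact combination_mem x _ _ _ (cutoff_nonneg _ _) (cutoff_le_one _ _) fun s hs => hK s hs n
  let H : SCRealization K × unitInterval → SCRealization K := fun p => ⟨_, hmem p.1 p.2⟩
  have hHapply : ∀ (s : Finset V) (p : ClosedSimplex K s × unitInterval) (u : V),
      (H (ClosedSimplex.incl K s p.1, p.2)).1 u =
        ∑ v ∈ s, (ClosedSimplex.incl K s p.1).1 v * vertexPath r N (p.2 : ℝ) v u := by
    intro s p u
    change ((ClosedSimplex.incl K s p.1).1.sum fun v w => w • vertexPath r N (p.2 : ℝ) v) u = _
    rw [Finsupp.sum_of_support_subset _ (show (ClosedSimplex.incl K s p.1).1.support ⊆ s from p.1.2)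
      _ (by simp), Finsupp.finsetSum_apply]
    rfl
  have hH : Continuous H := by
    refine continuous_prod_of_closedSimplex H fun s hs => ?_
    -- Over a simplex `s`, the homotopy only meets the vertices `r n v` with `v ∈ s` and `n ≤ N v`,
    -- a finite set.
    refine continuous_of_finite _
      (s.biUnion fun v => (Finset.range (N v + 1)).image fun n => r n v) ?_ ?_
    · intro p u hu
      by_contra hu'
      refine Finsupp.mem_support_iff.1 hu ?_
      rw [hHapply]
      refine Finset.sum_eq_zero fun v hv => ?_
      rw [vertexPath_apply_eq_zero r N hN, mul_zero]
      intro n hn h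
      exact hu' (Finset.mem_biUnion.2 ⟨v, hv, Finset.mem_image.2
        ⟨n, Finset.mem_range.2 (by omega), h⟩⟩)
    · intro u
      simp only [hHapply]
      refine continuous_finsetSum _ fun v _ => ?_
      exact ((ClosedSimplex.continuous_coord s v).comp continuous_fst).mul
        ((continuous_vertexPath r N v u).comp (continuous_subtype_val.comp continuous_snd))
  have hsupp : (Finsupp.single v₀ (1 : ℝ)).support = {v₀} :=
    Finsupp.support_single _ one_ne_zero
  let p₀ : SCRealization K := ⟨Finsupp.single v₀ 1, by rw [hsupp]; exact hv₀, by
    intro v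
    rw [Finsupp.single_apply]
    split_ifs <;> norm_num, by simp⟩
  rw [contractible_iff_id_nullhomotopic]
  refine ⟨p₀, ⟨⟨⟨fun p => H (p.2, p.1), by fun_prop⟩, ?_, ?_⟩⟩⟩
  · intro x
    refine Subtype.ext ?_
    change (x.1.sum fun v w => w • vertexPath r N (((0 : unitInterval) : ℝ)) v) = x.1
    rw [Set.Icc.coe_zero, ← Finsupp.sum_single x.1]
    simp only [vertexPath_zero, Finsupp.smul_single, smul_eq_mul, mul_one, Finsupp.sum_single]
  · intro x
    refine Subtype.ext ?_
    change (x.1.sum fun v w => w • vertexPath r N (((1 : unitInterval) : ℝ)) v) =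
      Finsupp.single v₀ 1
    have h1 : ∀ v ∈ x.1.support, vertexPath r N (((1 : unitInterval) : ℝ)) v =
        Finsupp.single v₀ 1 := by
      intro v hv
      have h : ∀ n : ℕ, cutoff n 1 = 1 := fun n =>
        cutoff_eq_one (by linarith [(Nat.cast_nonneg n : (0 : ℝ) ≤ n)])
      simp only [vertexPath, Set.Icc.coe_one, h, one_smul]
      rw [Finset.sum_range_sub' fun n => Finsupp.single (r n v) (1 : ℝ), hN v (N v) le_rfl,
        hr₀ _ x.2.1 v hv]
      abel
    rw [Finsupp.sum, Finset.sum_congr rfl fun v hv => by rw [h1 v hv], ← Finset.sum_smul]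
    have := x.2.2.2
    rw [Finsupp.sum] at this
    rw [this, one_smul]

end SCRealization

/-! ### Shrinking along a rank function -/

section Shrink

/-- Iterate the rank-decreasing map `π` until the rank is at most `n`. -/
noncomputable def shrink {V : Type u} (ρ : V → ℕ) (π : V → V)
    (hπ : ∀ v, ρ v ≠ 0 → ρ (π v) < ρ v) (n : ℕ) (v : V) : V :=
  if _h : ρ v ≤ n then v else shrink ρ π hπ n (π v)
termination_by ρ v
decreasing_by exact hπ v (by omega)

variable {V : Type u} (ρ : V → ℕ) (π : V → V) (hπ : ∀ v, ρ v ≠ 0 → ρ (π v) < ρ v)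

theorem shrink_of_le {n : ℕ} {v : V} (h : ρ v ≤ n) : shrink ρ π hπ n v = v := by
  rw [shrink, dif_pos h]

theorem shrink_of_lt {n : ℕ} {v : V} (h : n < ρ v) :
    shrink ρ π hπ n v = shrink ρ π hπ n (π v) := by
  rw [shrink, dif_neg (by omega)]

theorem shrink_mem {A : Set V} (hA : ∀ v ∈ A, π v ∈ A) (n : ℕ) (v : V) (hv : v ∈ A) :
    shrink ρ π hπ n v ∈ A := by
  induction h : ρ v using Nat.strong_induction_on generalizing v with
  | _ k ih =>
    subst h
    rcases le_or_gt (ρ v) n with h | h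
    · rwa [shrink_of_le ρ π hπ h]
    · rw [shrink_of_lt ρ π hπ h]
      exact ih _ (hπ v (by omega)) _ (hA v hv) rfl

theorem rank_shrink_le (n : ℕ) (v : V) : ρ (shrink ρ π hπ n v) ≤ n := by
  induction h : ρ v using Nat.strong_induction_on generalizing v with
  | _ k ih =>
    subst h
    rcases le_or_gt (ρ v) n with h | h
    · rwa [shrink_of_le ρ π hπ h]
    · rw [shrink_of_lt ρ π hπ h]
      exact ih _ (hπ v (by omega)) _ rfl

/-- Always moving an endpoint of larger rank preserves `R`. Thresholds differing by at most one
never force a move of an endpoint of strictly smaller rank. -/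
theorem shrink_rel {A : Set V} (hA : ∀ v ∈ A, π v ∈ A) {R : V → V → Prop}
    (hsymm : ∀ a b, R a b → R b a)
    (hR : ∀ a ∈ A, ∀ b ∈ A, R a b → ρ b ≤ ρ a → R (π a) b) {n m : ℕ} (hnm : n ≤ m)
    (hmn : m ≤ n + 1) (a b : V) (ha : a ∈ A) (hb : b ∈ A) (hab : R a b) :
    R (shrink ρ π hπ n a) (shrink ρ π hπ m b) := by
  induction h : ρ a + ρ b using Nat.strong_induction_on generalizing a b with
  | _ k ih =>
    subst h
    rcases le_total (ρ b) (ρ a) with hle | hle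
    · rcases le_or_gt (ρ a) n with h | h
      · rwa [shrink_of_le ρ π hπ h, shrink_of_le ρ π hπ (hle.trans (h.trans hnm))]
      · rw [shrink_of_lt ρ π hπ h]
        have := hπ a (by omega)
        exact ih _ (by omega) _ _ (hA a ha) hb (hR a ha b hb hab hle) rfl
    · rcases le_or_gt (ρ b) m with h | h
      · rcases le_or_gt (ρ a) n with h' | h'
        · rwa [shrink_of_le ρ π hπ h', shrink_of_le ρ π hπ h]
        -- Here `n < ρ a ≤ ρ b ≤ m ≤ n + 1`, so the ranks are equal and `a` may be moved.
        · rw [shrink_of_lt ρ π hπ h']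
          have := hπ a (by omega)
          exact ih _ (by omega) _ _ (hA a ha) hb (hR a ha b hb hab (by omega)) rfl
      · rw [shrink_of_lt ρ π hπ h]
        have := hπ b (by omega)
        exact ih _ (by omega) _ _ ha (hA b hb)
          (hsymm _ _ (hR b hb a ha (hsymm _ _ hab) hle)) rfl

end Shrink

/-! ### Rips complexes of hyperbolic graphs -/

section Rips

variable {V : Type u} {G : SimpleGraph V}

theorem SimpleGraph.Connected.edist_le_coe_iff (hG : G.Connected) {a b : V} {n : ℕ} :
    G.edist a b ≤ (n : ℕ∞) ↔ G.dist a b ≤ n := by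
  rw [← (hG a b).coe_dist_eq_edist, Nat.cast_le]

theorem SimpleGraph.Walk.dist_add_dist_of_mem (hG : G.Connected) {a b c : V} (p : G.Walk a b)
    (hp : p.length = G.dist a b) (hc : c ∈ p.support) :
    G.dist a c + G.dist c b = G.dist a b := by
  classical
  have h1 := G.dist_le (p.takeUntil c hc)
  have h2 := G.dist_le (p.dropUntil c hc)
  have h3 := congrArg SimpleGraph.Walk.length (p.take_spec hc)
  rw [SimpleGraph.Walk.length_append] at h3
  have := hG.dist_triangle (u := a) (v := c) (w := b)
  omega

theorem SimpleGraph.Walk.exists_mem_dist_eq (hG : G.Connected) {a b : V} (p : G.Walk a b)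
    (hp : p.length = G.dist a b) {n : ℕ} (hn : n ≤ G.dist a b) :
    ∃ c ∈ p.support, G.dist a c + n = G.dist a b ∧ G.dist c b = n := by
  have h := p.dist_add_dist_of_mem hG hp (p.getVert_mem_support (G.dist a b - n))
  refine ⟨_, p.getVert_mem_support (G.dist a b - n), ?_⟩
  have h1 := G.dist_le (p.take (G.dist a b - n))
  have h2 := G.dist_le (p.drop (G.dist a b - n))
  rw [SimpleGraph.Walk.take_length] at h1
  rw [SimpleGraph.Walk.drop_length] at h2
  omega

/-- Take `b` within `δ` of `c` on another side of the triangle `o`, `v`, `w`. On either side, `b` is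
at most `κ - κ / 2 + δ` from `w`, so `c` is at most `κ - κ / 2 + 2 * δ ≤ κ` from `w`. -/
theorem IsHyperbolicGraph.dist_le_of_geodesic {δ κ : ℕ} (hδ : IsHyperbolicGraph G δ)
    (hG : G.Connected) (hκ : 4 * δ ≤ κ) {o v w c : V} (p : G.Walk o v)
    (hp : p.length = G.dist o v) (hc : c ∈ p.support) (hcv : G.dist c v = κ / 2)
    (hvw : G.dist v w ≤ κ) (how : G.dist o w ≤ G.dist o v) : G.dist c w ≤ κ := by
  obtain ⟨q, hq⟩ := hG.exists_walk_length_eq_dist v w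
  obtain ⟨r, hr⟩ := hG.exists_walk_length_eq_dist o w
  obtain ⟨b, hb, hcb⟩ := hδ o v w p q r hp hq hr c hc
  rw [hG.edist_le_coe_iff] at hcb
  have h1 := p.dist_add_dist_of_mem hG hp hc
  have h2 := hG.dist_triangle (u := c) (v := b) (w := w)
  rcases hb with hb | hb
  · have h3 := q.dist_add_dist_of_mem hG hq hb
    have h4 := hG.dist_triangle (u := c) (v := b) (w := v)
    rw [G.dist_comm (u := b) (v := v)] at h4
    omega
  · have h3 := r.dist_add_dist_of_mem hG hr hb
    have h4 := hG.dist_triangle (u := o) (v := b) (w := c)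
    rw [G.dist_comm (u := b) (v := c)] at h4
    omega

/-- In the Rips complex of a hyperbolic graph, full subcomplexes on sets which are star-shaped for
geodesics are contractible. -/
theorem contractibleSpace_ripsComplex_of_starShaped {δ κ : ℕ} (hδ : IsHyperbolicGraph G δ)
    (hG : G.Connected) (hκ : 4 * δ ≤ κ) (hκ₂ : 2 ≤ κ) (A : Set V) (o : V) (ho : o ∈ A)
    (hA : ∀ v ∈ A, ∃ p : G.Walk o v, p.length = G.dist o v ∧ ∀ a ∈ p.support, a ∈ A) :
    ContractibleSpace (SCRealization (fullSubcomplex (ripsComplex G κ) A)) := by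
  classical
  have key : ∀ v : V, ∃ c : V, (G.dist o v ≠ 0 → G.dist o c < G.dist o v) ∧ (v ∈ A → c ∈ A ∧
      ∀ w, G.dist v w ≤ κ → G.dist o w ≤ G.dist o v → G.dist c w ≤ κ) := by
    intro v
    -- Since `2 ≤ κ`, stepping back by `κ / 2` strictly decreases the distance to `o`. Vertices
    -- closer than `κ / 2`, and irrelevant ones outside `A`, go straight to `o`.
    by_cases hv : v ∈ A ∧ κ / 2 ≤ G.dist o v
    · obtain ⟨p, hp, hpA⟩ := hA v hv.1
      obtain ⟨c, hc, hoc, hcv⟩ := p.exists_mem_dist_eq hG hp hv.2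
      exact ⟨c, fun _ => by omega, fun _ => ⟨hpA c hc, fun w hvw how =>
        hδ.dist_le_of_geodesic hG hκ p hp hc hcv hvw how⟩⟩
    · refine ⟨o, fun h => by rw [SimpleGraph.dist_self]; omega, fun hvA => ⟨ho, fun w _ how => ?_⟩⟩
      have : ¬ κ / 2 ≤ G.dist o v := fun h => hv ⟨hvA, h⟩
      omega
  choose π hπ hπA using key
  set r := shrink (G.dist o) π hπ with hr
  have hface : ∀ s : Finset V, s ∈ (fullSubcomplex (ripsComplex G κ) A).faces ↔
      (s.Nonempty ∧ ∀ a ∈ s, ∀ b ∈ s, G.dist a b ≤ κ) ∧ ∀ a ∈ s, a ∈ A := by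
    intro s
    simp only [← hG.edist_le_coe_iff]
    exact Iff.rfl
  have hrel : ∀ n m, n ≤ m → m ≤ n + 1 → ∀ a ∈ A, ∀ b ∈ A, G.dist a b ≤ κ →
      G.dist (r n a) (r m b) ≤ κ := fun n m hnm hmn a ha b hb hab =>
    shrink_rel (G.dist o) π hπ (fun v hv => (hπA v hv).1)
      (R := fun a b => G.dist a b ≤ κ) (fun a b h => by rwa [G.dist_comm])
      (fun a ha b _ hab hle => (hπA a ha).2 b hab hle) hnm hmn a b ha hb hab
  have hrA : ∀ n, ∀ a ∈ A, r n a ∈ A := fun n a ha =>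
    shrink_mem (G.dist o) π hπ (fun v hv => (hπA v hv).1) n a ha
  refine SCRealization.contractibleSpace_of_contiguous r (G.dist o) o ?_ ?_ ?_ ?_
  · rw [hface]
    simp [ho]
  · exact fun v n h => shrink_of_le _ _ _ h
  · intro s _ v _
    have := rank_shrink_le (G.dist o) π hπ 0 v
    exact (hG.dist_eq_zero_iff.1 (Nat.le_zero.1 this)).symm
  · intro s hs n
    rw [hface] at hs ⊢
    obtain ⟨⟨hne, hd⟩, hsA⟩ := hs
    refine ⟨⟨(hne.image _).mono Finset.subset_union_left, ?_⟩, ?_⟩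
    · intro a ha b hb
      simp only [Finset.mem_union, Finset.mem_image] at ha hb
      rcases ha with ⟨a, ha, rfl⟩ | ⟨a, ha, rfl⟩ <;> rcases hb with ⟨b, hb, rfl⟩ | ⟨b, hb, rfl⟩
      · exact hrel _ _ le_rfl (by omega) a (hsA a ha) b (hsA b hb) (hd a ha b hb)
      · exact hrel _ _ (by omega) le_rfl a (hsA a ha) b (hsA b hb) (hd a ha b hb)
      · rw [G.dist_comm]
        exact hrel _ _ (by omega) le_rfl b (hsA b hb) a (hsA a ha) (hd b hb a ha)
      · exact hrel _ _ le_rfl (by omega) a (hsA a ha) b (hsA b hb) (hd a ha b hb)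
    · intro a ha
      simp only [Finset.mem_union, Finset.mem_image] at ha
      rcases ha with ⟨a, ha, rfl⟩ | ⟨a, ha, rfl⟩ <;> exact hrA _ a (hsA a ha)

/-! ### Distances in the 1-skeleton of the Rips complex -/

theorem dist_le_mul_of_walk_oneSkeleton (hG : G.Connected) {κ : ℕ} {a b : V}
    (p : (oneSkeleton (ripsComplex G κ)).Walk a b) : G.dist a b ≤ κ * p.length := by
  induction p with
  | nil => simp
  | @cons a c b h p ih =>
    have hac : G.dist a c ≤ κ := by
      rw [← hG.edist_le_coe_iff]
      obtain ⟨-, ⟨s, hs, ha, hc⟩ | ⟨s, hs, hc, ha⟩⟩ := h <;> exact hs.2 a ha c hc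
    have := hG.dist_triangle (u := a) (v := c) (w := b)
    rw [SimpleGraph.Walk.length_cons, Nat.mul_succ]
    omega

theorem edist_oneSkeleton_le_one (hG : G.Connected) {κ : ℕ} {a b : V} (h : G.dist a b ≤ κ) :
    (oneSkeleton (ripsComplex G κ)).edist a b ≤ 1 := by
  classical
  rw [SimpleGraph.edist_le_one_iff_adj_or_eq, or_iff_not_imp_right]
  refine fun hab => ⟨hab, Or.inl ⟨{a, b}, ⟨by simp, ?_⟩, by simp, by simp⟩⟩
  simp only [hG.edist_le_coe_iff, Finset.mem_insert, Finset.mem_singleton]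
  rintro x (rfl | rfl) y (rfl | rfl)
  · simp
  · exact h
  · rwa [G.dist_comm]
  · simp

theorem edist_oneSkeleton_le_iff (hG : G.Connected) {κ : ℕ} {a b : V} {n : ℕ} :
    (oneSkeleton (ripsComplex G κ)).edist a b ≤ (n : ℕ∞) ↔ G.dist a b ≤ κ * n := by
  constructor
  · intro h
    obtain ⟨p, hp⟩ := SimpleGraph.exists_walk_of_edist_ne_top
      (ne_top_of_le_ne_top (ENat.natCast_ne_top n) h)
    rw [← hp, Nat.cast_le] at h
    exact (dist_le_mul_of_walk_oneSkeleton hG p).trans (Nat.mul_le_mul_left _ h)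
  · induction n generalizing b with
    | zero =>
      intro h
      have : a = b := hG.dist_eq_zero_iff.1 (by omega)
      simp [this]
    | succ n ih =>
      intro h
      obtain ⟨p, hp⟩ := hG.exists_walk_length_eq_dist a b
      -- The minimum covers the case where `a` is closer than `κ`; then `c = a`.
      obtain ⟨c, -, hc, hcb⟩ := p.exists_mem_dist_eq hG hp (min_le_right κ (G.dist a b))
      refine (oneSkeleton (ripsComplex G κ)).edist_triangle (v := c) |>.trans ?_
      rw [Nat.cast_succ]
      refine add_le_add (ih ?_) (edist_oneSkeleton_le_one hG (by omega))
      rw [Nat.mul_succ] at h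
      omega

theorem contractibleSpace_ripsComplex {δ κ : ℕ} (hδ : IsHyperbolicGraph G δ)
    (hG : G.Connected) (hκ : 4 * δ ≤ κ) (hκ₂ : 2 ≤ κ) :
    ContractibleSpace (SCRealization (ripsComplex G κ)) := by
  have h : fullSubcomplex (ripsComplex G κ) Set.univ = ripsComplex G κ := by
    ext s
    simp [fullSubcomplex]
  obtain ⟨o⟩ := hG.nonempty
  rw [← h]
  refine contractibleSpace_ripsComplex_of_starShaped hδ hG hκ hκ₂ _ o (Set.mem_univ o) fun v _ => ?_
  obtain ⟨p, hp⟩ := hG.exists_walk_length_eq_dist o v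
  exact ⟨p, hp, fun a _ => Set.mem_univ a⟩

theorem contractibleSpace_complexBall_ripsComplex {δ κ : ℕ} (hδ : IsHyperbolicGraph G δ)
    (hG : G.Connected) (hκ : 4 * δ ≤ κ) (hκ₂ : 2 ≤ κ) (o : V) (n : ℕ) :
    ContractibleSpace (SCRealization (complexBall (ripsComplex G κ) o n)) := by
  refine contractibleSpace_ripsComplex_of_starShaped hδ hG hκ hκ₂ _ o (by simp) fun v hv => ?_
  obtain ⟨p, hp⟩ := hG.exists_walk_length_eq_dist o v
  refine ⟨p, hp, fun a ha => ?_⟩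
  have h1 := (edist_oneSkeleton_le_iff hG).1 hv
  have h2 := p.dist_add_dist_of_mem hG hp ha
  exact (edist_oneSkeleton_le_iff hG).2 (by omega)

end Rips

/-! ### Vertices of the cusped graph -/

section Vertex

variable {Γ : Type u} {I : Type v}

theorem CuspedVertex.triple_injective {h k : Γ} {i : I} {n m : ℕ}
    (H : CuspedVertex.triple h i n = CuspedVertex.triple k i m) : h = k ∧ n = m := by
  cases n <;> cases m <;> simp_all [CuspedVertex.triple]

theorem CuspedVertex.triple_eq_deep {h k : Γ} {i j : I} {n m : ℕ}
    (H : CuspedVertex.triple h i n = CuspedVertex.deep k j m) : h = k ∧ i = j ∧ n = m + 1 := by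
  cases n <;> simp_all [CuspedVertex.triple]

/-- The height of a vertex of the cusped graph. -/
def CuspedVertex.height : CuspedVertex Γ I → ℕ
  | base _ => 0
  | deep _ _ n => n + 1

@[simp]
theorem CuspedVertex.height_triple (g : Γ) (i : I) (n : ℕ) :
    (CuspedVertex.triple g i n).height = n := by
  cases n <;> rfl

/-- Push the vertices of the horoballs up to height at least `C`. -/
def CuspedVertex.pushUp (C : ℕ) : CuspedVertex Γ I → CuspedVertex Γ I
  | base g => base g
  | deep g i n => triple g i (max (n + 1) C)

end Vertex

/-! ### Adjacency in the cusped graph -/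

section Cusped

variable {Γ : Type u} [Group Γ] {I : Type v} {P : I → Subgroup Γ} {S : Set Γ}

/-- Two elements of a common coset of `P i` span a horizontal edge of height `n` or are equal. -/
def IsHorizontal (P : I → Subgroup Γ) (S : Set Γ) (i : I) (n : ℕ) (h k : Γ) : Prop :=
  ∃ (g : Γ) (hh : h ∈ leftCosetSet (P i) g) (hk : k ∈ leftCosetSet (P i) g),
    ((SimpleGraph.mulCayley S).induce (leftCosetSet (P i) g)).edist ⟨h, hh⟩ ⟨k, hk⟩ ≤
      ((2 ^ n : ℕ) : ℕ∞)

theorem IsHorizontal.mono {i : I} {m n : ℕ} (hmn : m ≤ n) {h k : Γ}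
    (H : IsHorizontal P S i m h k) : IsHorizontal P S i n h k := by
  obtain ⟨g, hh, hk, H⟩ := H
  exact ⟨g, hh, hk, H.trans (Nat.cast_le.2 (Nat.pow_le_pow_right (by omega) hmn))⟩

theorem IsHorizontal.symm {i : I} {n : ℕ} {h k : Γ}
    (H : IsHorizontal P S i n h k) : IsHorizontal P S i n k h := by
  obtain ⟨g, hh, hk, H⟩ := H
  exact ⟨g, hk, hh, by rwa [SimpleGraph.edist_comm]⟩

theorem mem_leftCosetSet_of_mem {H : Subgroup Γ} {g g' h k : Γ} (hh : h ∈ leftCosetSet H g)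
    (hk : k ∈ leftCosetSet H g) (hh' : h ∈ leftCosetSet H g') : k ∈ leftCosetSet H g' := by
  have h1 : g'⁻¹ * h * (g⁻¹ * h)⁻¹ * (g⁻¹ * k) ∈ H := H.mul_mem (H.mul_mem hh' (H.inv_mem hh)) hk
  change g'⁻¹ * k ∈ H
  convert h1 using 1
  group

theorem self_mem_leftCosetSet (H : Subgroup Γ) (g : Γ) : g ∈ leftCosetSet H g := by
  simp [leftCosetSet]

theorem cuspedGraph_adj_iff (x y : CuspedVertex Γ I) :
    (cuspedGraph P S).Adj x y ↔ x ≠ y ∧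
      ((∃ g h, (SimpleGraph.mulCayley S).Adj g h ∧ x = .base g ∧ y = .base h) ∨
      ∃ i h k n m, x = .triple h i n ∧ y = .triple k i m ∧
        ((h = k ∧ (m = n + 1 ∨ n = m + 1)) ∨ (n = m ∧ IsHorizontal P S i n h k))) := by
  simp only [cuspedGraph, SimpleGraph.sup_adj, SimpleGraph.iSup_adj, SimpleGraph.map_adj',
    combinatorialHoroball, SimpleGraph.fromRel_adj]
  constructor
  · rintro (⟨hne, g, h, hgh, rfl, rfl⟩ | ⟨i, g, hne, ⟨⟨h, hh⟩, n⟩, ⟨⟨k, hk⟩, m⟩, ⟨-, hr⟩, rfl, rfl⟩)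
    · exact ⟨hne, Or.inl ⟨g, h, hgh, rfl, rfl⟩⟩
    · refine ⟨hne, Or.inr ⟨i, h, k, n, m, rfl, rfl, ?_⟩⟩
      simp only [Subtype.mk.injEq] at hr
      rcases hr with (⟨h1, h2⟩ | ⟨h1, h2⟩) | (⟨h1, h2⟩ | ⟨h1, h2⟩)
      · exact Or.inl ⟨h1, Or.inl h2⟩
      · exact Or.inr ⟨h1, g, hh, hk, h2⟩
      · exact Or.inl ⟨h1.symm, Or.inr h2⟩
      · subst h1
        exact Or.inr ⟨rfl, g, hh, hk, by rwa [SimpleGraph.edist_comm]⟩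
  · rintro ⟨hne, ⟨g, h, hgh, rfl, rfl⟩ | ⟨i, h, k, n, m, rfl, rfl, ⟨rfl, H⟩ | ⟨rfl, g, hh, hk, H⟩⟩⟩
    · exact Or.inl ⟨hne, g, h, hgh, rfl, rfl⟩
    · refine Or.inr ⟨i, h, hne, (⟨h, self_mem_leftCosetSet _ h⟩, n),
        (⟨h, self_mem_leftCosetSet _ h⟩, m), ⟨fun h0 => hne ?_, ?_⟩, rfl, rfl⟩
      · rw [(Prod.mk.inj h0).2]
      · rcases H with H | H
        · exact Or.inl (Or.inl ⟨rfl, H⟩)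
        · exact Or.inr (Or.inl ⟨rfl, H⟩)
    · refine Or.inr ⟨i, g, hne, (⟨h, hh⟩, n), (⟨k, hk⟩, n), ⟨fun h0 => hne ?_, ?_⟩, rfl, rfl⟩
      · simp only [Prod.mk.injEq, Subtype.mk.injEq] at h0
        rw [h0.1]
      · exact Or.inl (Or.inr ⟨rfl, H⟩)

theorem cuspedGraph_adj_up (h : Γ) (i : I) (n : ℕ) :
    (cuspedGraph P S).Adj (.triple h i n) (.triple h i (n + 1)) := by
  refine (cuspedGraph_adj_iff _ _).2 ⟨fun H => ?_, Or.inr ⟨i, h, h, n, n + 1, rfl, rfl,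
    Or.inl ⟨rfl, Or.inl rfl⟩⟩⟩
  have := (CuspedVertex.triple_injective H).2
  omega

theorem cuspedGraph_adj_horizontal {h k : Γ} {i : I} {n : ℕ} (hne : h ≠ k)
    (H : IsHorizontal P S i n h k) :
    (cuspedGraph P S).Adj (.triple h i n) (.triple k i n) :=
  (cuspedGraph_adj_iff _ _).2 ⟨fun H => hne (CuspedVertex.triple_injective H).1,
    Or.inr ⟨i, h, k, n, n, rfl, rfl, Or.inr ⟨rfl, H⟩⟩⟩

theorem cuspedGraph_adj_deep {h : Γ} {i : I} {n : ℕ} {y : CuspedVertex Γ I}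
    (hadj : (cuspedGraph P S).Adj (.deep h i n) y) :
    ∃ k m, y = .triple k i m ∧
      ((h = k ∧ (m = n + 2 ∨ m = n)) ∨ (m = n + 1 ∧ IsHorizontal P S i m h k)) := by
  obtain ⟨-, ⟨g, k, -, h1, -⟩ | ⟨j, g, k, n', m, h1, rfl, H⟩⟩ := (cuspedGraph_adj_iff _ _).1 hadj
  · cases h1
  · obtain ⟨rfl, rfl, rfl⟩ := CuspedVertex.triple_eq_deep h1.symm
    refine ⟨k, m, rfl, ?_⟩
    rcases H with ⟨h1, h2⟩ | ⟨rfl, H⟩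
    · exact Or.inl ⟨h1, by omega⟩
    · exact Or.inr ⟨rfl, H⟩

/-! ### Connectedness -/

/-- As `S ∩ P i` generates `P i`, the full Cayley subgraph on a coset is connected, and a walk of
length `n` bounds the distance by `n ≤ 2 ^ n`. -/
theorem exists_isHorizontal (hS : IsCompatibleGeneratingSet P S) (i : I) {h k : Γ}
    (hk : k ∈ leftCosetSet (P i) h) : ∃ n, IsHorizontal P S i n h k := by
  have hsub : ∀ p ∈ Subgroup.closure (S ∩ (P i : Set Γ)), p ∈ P i := by
    intro p hp
    rwa [hS.closure_inter i] at hp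
  have hreach : ∀ p (hp : p ∈ Subgroup.closure (S ∩ (P i : Set Γ))),
      ((SimpleGraph.mulCayley S).induce (leftCosetSet (P i) h)).Reachable
        ⟨h, self_mem_leftCosetSet _ h⟩
        ⟨h * p, by simpa [leftCosetSet] using hsub p hp⟩ := by
    intro p hp
    have hstep : ∀ (p s : Γ) (hp : p ∈ P i) (hs : s ∈ P i), s ∈ S →
        ((SimpleGraph.mulCayley S).induce (leftCosetSet (P i) h)).Adj
          ⟨h * p, by simpa [leftCosetSet] using hp⟩
          ⟨h * (p * s), by simpa [leftCosetSet] using mul_mem hp hs⟩ := by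
      intro p s hp hs hsS
      rw [SimpleGraph.comap_adj, SimpleGraph.mulCayley_adj]
      refine ⟨fun h0 => ?_, Or.inl ?_⟩
      · have h1 : h * p = h * (p * s) := h0
        rw [← mul_assoc, left_eq_mul] at h1
        exact hS.one_notMem (h1 ▸ hsS)
      · change (h * p)⁻¹ * (h * (p * s)) ∈ S
        convert hsS using 1
        group
    induction hp using Subgroup.closure_induction_right with
    | one =>
      convert SimpleGraph.Reachable.refl _ using 2
      exact mul_one h
    | mul_right x hx y hy ih =>
      exact ih.trans (hstep x y (hsub x hx) hy.2 hy.1).reachable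
    | mul_inv_cancel x hx y hy ih =>
      exact ih.trans (hstep x y⁻¹ (hsub x hx) (inv_mem hy.2) (hS.inv_mem y hy.1)).reachable
  obtain ⟨p, hp⟩ := SimpleGraph.exists_walk_of_edist_ne_top
    (SimpleGraph.edist_ne_top_iff_reachable.2 (hreach (h⁻¹ * k) (by rw [hS.closure_inter i]; exact hk)))
  refine ⟨p.length, h, self_mem_leftCosetSet _ h, hk, ?_⟩
  have h1 := SimpleGraph.edist_le p
  simp only [mul_inv_cancel_left] at h1
  exact h1.trans (Nat.cast_le.2 Nat.lt_two_pow_self.le)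

theorem exists_vertical_walk (i : I) (g h : Γ) (hh : h ∈ leftCosetSet (P i) g) (n k : ℕ) :
    ∃ p : (cuspedGraph P S).Walk (.triple h i n) (.triple h i (n + k)),
      p.length = k ∧ ∀ a ∈ p.support, a ∈ horoballVertices P i g n := by
  induction k with
  | zero =>
    refine ⟨SimpleGraph.Walk.nil, rfl, fun a ha => ?_⟩
    rw [SimpleGraph.Walk.support_nil, List.mem_singleton] at ha
    exact ⟨h, hh, n, le_rfl, ha⟩
  | succ k ih =>
    obtain ⟨p, hp, hpA⟩ := ih
    refine ⟨p.concat (cuspedGraph_adj_up h i (n + k)), by rw [SimpleGraph.Walk.length_concat, hp],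
      fun a ha => ?_⟩
    rw [SimpleGraph.Walk.support_concat, List.mem_append, List.mem_singleton] at ha
    rcases ha with ha | rfl
    · exact hpA a ha
    · exact ⟨h, hh, n + (k + 1), by omega, rfl⟩

theorem cuspedGraph_connected (hS : IsCompatibleGeneratingSet P S) :
    (cuspedGraph P S).Connected := by
  have hbase : ∀ g : Γ, (cuspedGraph P S).Reachable (.base 1) (.base g) := by
    intro g
    have hstep : ∀ x s : Γ, s ∈ S → (cuspedGraph P S).Reachable (.base x) (.base (x * s)) := by
      intro x s hs
      have hne : x ≠ x * s := by
        intro h0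
        rw [left_eq_mul] at h0
        exact hS.one_notMem (h0 ▸ hs)
      refine SimpleGraph.Adj.reachable ((cuspedGraph_adj_iff _ _).2 ⟨fun h0 => hne ?_,
        Or.inl ⟨x, x * s, (SimpleGraph.mulCayley_adj S _ _).2 ⟨hne, Or.inl ?_⟩, rfl, rfl⟩⟩)
      · injection h0
      · simpa using hs
    have hg : g ∈ Subgroup.closure S := by rw [hS.closure_eq_top]; trivial
    induction hg using Subgroup.closure_induction_right with
    | one => exact SimpleGraph.Reachable.refl _
    | mul_right x _ y hy ih => exact ih.trans (hstep x y hy)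
    | mul_inv_cancel x _ y hy ih => exact ih.trans (hstep x y⁻¹ (hS.inv_mem y hy))
  have hall : ∀ x : CuspedVertex Γ I, (cuspedGraph P S).Reachable (.base 1) x := by
    rintro (g | ⟨g, i, n⟩)
    · exact hbase g
    · obtain ⟨p, -⟩ := exists_vertical_walk (P := P) (S := S) i g g (self_mem_leftCosetSet _ g) 0
        (n + 1)
      rw [Nat.zero_add] at p
      exact (hbase g).trans ⟨p⟩
  have : Nonempty (CuspedVertex Γ I) := ⟨.base 1⟩
  exact ⟨fun x y => (hall x).symm.trans (hall y)⟩

/-! ### Convexity of deep horoballs -/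

theorem height_le_of_adj {x y : CuspedVertex Γ I} (H : (cuspedGraph P S).Adj x y) :
    y.height ≤ x.height + 1 := by
  obtain ⟨-, ⟨g, h, -, rfl, rfl⟩ | ⟨i, h, k, n, m, rfl, rfl, H⟩⟩ := (cuspedGraph_adj_iff _ _).1 H
  · exact Nat.zero_le _
  · rw [CuspedVertex.height_triple, CuspedVertex.height_triple]
    omega

theorem height_le_of_walk {x y : CuspedVertex Γ I} (p : (cuspedGraph P S).Walk x y) :
    y.height ≤ x.height + p.length := by
  induction p with
  | nil => simp
  | cons h p ih =>
    have := height_le_of_adj h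
    rw [SimpleGraph.Walk.length_cons]
    omega

/-- Height grows by at most one per edge, so every edge of such a walk goes up, and the only upward
edge at a deep vertex is vertical. A base vertex would offer one column for each index. -/
theorem eq_triple_of_steep_walk {x y : CuspedVertex Γ I} (p : (cuspedGraph P S).Walk x y)
    {h : Γ} {i : I} {n : ℕ} (hx : x = .deep h i n) (hp : x.height + p.length ≤ y.height) :
    ∃ m, y = .deep h i m := by
  induction p generalizing n with
  | nil => exact ⟨n, hx⟩
  | @cons x c y hxc p ih =>
    subst hx
    have h1 := height_le_of_adj hxc
    have h2 := height_le_of_walk p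
    change n + 1 + (p.length + 1) ≤ y.height at hp
    change c.height ≤ n + 1 + 1 at h1
    obtain ⟨k, m, rfl, H⟩ := cuspedGraph_adj_deep hxc
    rw [CuspedVertex.height_triple] at h1 h2 ih
    rcases H with ⟨rfl, H⟩ | ⟨H, -⟩
    · obtain rfl : m = n + 2 := by omega
      exact ih rfl (by omega)
    · omega

/-- The geodesic is a vertical walk followed, if `h ≠ k`, by one horizontal edge at height `N`. The
climb alone costs `N - (n + 1)`, and a walk of exactly that length cannot leave the column of `h`.
-/
theorem exists_geodesic_to_top (hS : IsCompatibleGeneratingSet P S) (i : I) {g h k : Γ}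
    (hh : h ∈ leftCosetSet (P i) g) (hk : k ∈ leftCosetSet (P i) g) (n : ℕ) {N : ℕ}
    (hN : n + 1 ≤ N) (H : h = k ∨ IsHorizontal P S i N h k) :
    ∃ p : (cuspedGraph P S).Walk (.triple h i (n + 1)) (.triple k i N),
      p.length = (cuspedGraph P S).dist (.triple h i (n + 1)) (.triple k i N) ∧
        ∀ a ∈ p.support, a ∈ horoballVertices P i g (n + 1) := by
  obtain ⟨l, rfl⟩ := Nat.exists_eq_add_of_le hN
  obtain ⟨p, hp, hpA⟩ := exists_vertical_walk (S := S) i g h hh (n + 1) l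
  obtain ⟨q, hq⟩ := (cuspedGraph_connected hS).exists_walk_length_eq_dist
    (CuspedVertex.triple h i (n + 1)) (CuspedVertex.triple k i (n + 1 + l))
  have h1 := height_le_of_walk q
  simp only [CuspedVertex.height_triple] at h1
  by_cases hhk : h = k
  · subst hhk
    refine ⟨p, le_antisymm ?_ (SimpleGraph.dist_le p), hpA⟩
    omega
  · have hadj := cuspedGraph_adj_horizontal hhk (H.resolve_left hhk)
    refine ⟨p.concat hadj, le_antisymm ?_ (SimpleGraph.dist_le _), fun a ha => ?_⟩
    · rw [SimpleGraph.Walk.length_concat, hp, ← hq]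
      by_contra hlt
      obtain ⟨m, hm⟩ := eq_triple_of_steep_walk q rfl (by
        simp only [CuspedVertex.height_triple]
        omega)
      exact hhk (CuspedVertex.triple_eq_deep hm).1.symm
    · rw [SimpleGraph.Walk.support_concat, List.mem_append, List.mem_singleton] at ha
      rcases ha with ha | rfl
      · exact hpA a ha
      · exact ⟨k, hk, _, by omega, rfl⟩

/-! ### Staying in a horoball and pushing it upwards -/

theorem IsHorizontal.mem_leftCosetSet {i : I} {n : ℕ} {g h k : Γ} (H : IsHorizontal P S i n h k)
    (hh : h ∈ leftCosetSet (P i) g) : k ∈ leftCosetSet (P i) g := by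
  obtain ⟨g', h1, h2, -⟩ := H
  exact mem_leftCosetSet_of_mem h1 h2 hh

theorem mem_horoballVertices_of_adj {i : I} {g : Γ} {n : ℕ} {x y : CuspedVertex Γ I}
    (hx : x ∈ horoballVertices P i g (n + 1)) (hxy : (cuspedGraph P S).Adj x y) :
    y ∈ horoballVertices P i g n := by
  obtain ⟨h, hh, m, hm, rfl⟩ := hx
  obtain ⟨m, rfl⟩ := Nat.exists_eq_add_of_le' (show 1 ≤ m by omega)
  obtain ⟨k, l, rfl, H⟩ := cuspedGraph_adj_deep hxy
  rcases H with ⟨rfl, H⟩ | ⟨rfl, H⟩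
  · exact ⟨h, hh, l, by omega, rfl⟩
  · exact ⟨k, H.mem_leftCosetSet hh, _, by omega, rfl⟩

theorem mem_horoballVertices_of_walk {i : I} {g : Γ} {n : ℕ} {x y : CuspedVertex Γ I}
    (p : (cuspedGraph P S).Walk x y) (hx : x ∈ horoballVertices P i g (n + p.length)) :
    y ∈ horoballVertices P i g n := by
  induction p with
  | nil => exact hx
  | cons h p ih => exact ih (mem_horoballVertices_of_adj hx h)

theorem horoballVertices_anti {i : I} {g : Γ} {n m : ℕ} (hnm : n ≤ m) :
    horoballVertices P i g m ⊆ horoballVertices P i g n := by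
  rintro x ⟨h, hh, k, hk, rfl⟩
  exact ⟨h, hh, k, hnm.trans hk, rfl⟩

theorem pushUp_mem {i : I} {g : Γ} (C : ℕ) {x : CuspedVertex Γ I}
    (hx : x ∈ horoballVertices P i g 1) : x.pushUp C ∈ horoballVertices P i g C := by
  obtain ⟨h, hh, m, hm, rfl⟩ := hx
  obtain ⟨m, rfl⟩ := Nat.exists_eq_add_of_le' hm
  exact ⟨h, hh, _, le_max_right _ _, rfl⟩

theorem pushUp_eq_self {i : I} {g : Γ} {C : ℕ} {x : CuspedVertex Γ I} (hC : 1 ≤ C)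
    (hx : x ∈ horoballVertices P i g C) : x.pushUp C = x := by
  obtain ⟨h, hh, m, hm, rfl⟩ := hx
  obtain ⟨m, rfl⟩ := Nat.exists_eq_add_of_le' (hC.trans hm)
  change CuspedVertex.triple h i (max (m + 1) C) = _
  rw [max_eq_left hm]

/-- A vertical edge stays vertical or collapses. A horizontal edge survives at greater height
because the bound `2 ^ n` increases. Positive height matters because `pushUp` leaves base vertices
in place. -/
theorem pushUp_adj {i : I} {g : Γ} (C : ℕ) {x y : CuspedVertex Γ I}
    (hx : x ∈ horoballVertices P i g 1) (hy : y ∈ horoballVertices P i g 1)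
    (hxy : (cuspedGraph P S).Adj x y) :
    x.pushUp C = y.pushUp C ∨ (cuspedGraph P S).Adj (x.pushUp C) (y.pushUp C) := by
  obtain ⟨h, hh, n, hn, rfl⟩ := hx
  obtain ⟨n, rfl⟩ := Nat.exists_eq_add_of_le' hn
  obtain ⟨k, hk, m, hm, rfl⟩ := hy
  obtain ⟨m, rfl⟩ := Nat.exists_eq_add_of_le' hm
  obtain ⟨k', m', h1, H⟩ := cuspedGraph_adj_deep hxy
  obtain ⟨rfl, rfl⟩ := CuspedVertex.triple_injective h1
  change CuspedVertex.triple h i (max (n + 1) C) = CuspedVertex.triple k i (max (m + 1) C) ∨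
    (cuspedGraph P S).Adj (.triple h i (max (n + 1) C)) (.triple k i (max (m + 1) C))
  rcases H with ⟨rfl, H⟩ | ⟨H, H'⟩
  · rcases eq_or_ne (max (n + 1) C) (max (m + 1) C) with h0 | h0
    · exact Or.inl (by rw [h0])
    · rcases H with H | H
      · rw [show max (m + 1) C = max (n + 1) C + 1 by omega]
        exact Or.inr (cuspedGraph_adj_up _ _ _)
      · rw [show max (n + 1) C = max (m + 1) C + 1 by omega]
        exact Or.inr (cuspedGraph_adj_up _ _ _).symm
  · rw [H] at H' ⊢
    by_cases hhk : h = k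
    · exact Or.inl (by rw [hhk])
    · exact Or.inr (cuspedGraph_adj_horizontal hhk (H'.mono (le_max_left _ _)))

theorem exists_pushUp_walk {i : I} {g : Γ} (C : ℕ) {x y : CuspedVertex Γ I}
    (p : (cuspedGraph P S).Walk x y) (hp : ∀ a ∈ p.support, a ∈ horoballVertices P i g 1) :
    ∃ q : (cuspedGraph P S).Walk (x.pushUp C) (y.pushUp C), q.length ≤ p.length ∧
      ∀ a ∈ q.support, a ∈ horoballVertices P i g C := by
  induction p with
  | nil =>
    refine ⟨SimpleGraph.Walk.nil, le_rfl, fun a ha => ?_⟩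
    rw [SimpleGraph.Walk.support_nil, List.mem_singleton] at ha
    subst ha
    exact pushUp_mem C (hp _ (by simp))
  | @cons x c y h p ih =>
    have hx : x ∈ horoballVertices P i g 1 := hp x (by simp)
    have hc : c ∈ horoballVertices P i g 1 := hp c (by simp)
    obtain ⟨q, hq, hqA⟩ := ih fun a ha => hp a (by simp [ha])
    rw [SimpleGraph.Walk.length_cons]
    rcases pushUp_adj C hx hc h with h0 | h0
    · rw [h0]
      exact ⟨q, by omega, hqA⟩
    · refine ⟨SimpleGraph.Walk.cons h0 q, by rw [SimpleGraph.Walk.length_cons]; omega,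
        fun a ha => ?_⟩
      rw [SimpleGraph.Walk.support_cons, List.mem_cons] at ha
      rcases ha with rfl | ha
      · exact pushUp_mem C hx
      · exact hqA a ha

theorem exists_geodesic_in_horoball (hS : IsCompatibleGeneratingSet P S) {δ C : ℕ}
    (hδ : IsHyperbolicGraph (cuspedGraph P S) δ) (hC : δ < C) (i : I) (g : Γ)
    {x y : CuspedVertex Γ I} (hx : x ∈ horoballVertices P i g C)
    (hy : y ∈ horoballVertices P i g C) :
    ∃ p : (cuspedGraph P S).Walk x y, p.length = (cuspedGraph P S).dist x y ∧
      ∀ a ∈ p.support, a ∈ horoballVertices P i g C := by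
  have hG := cuspedGraph_connected hS
  obtain ⟨p, hp⟩ := hG.exists_walk_length_eq_dist x y
  -- The third corner lies above `x`, so high that the columns of `x` and `y` are equal or adjacent
  -- there. Both sides to it stay at height at least `C`, so `p` stays in the horoball at height at
  -- least `C - δ ≥ 1`.
  have hp1 : ∀ a ∈ p.support, a ∈ horoballVertices P i g 1 := by
    intro a ha
    obtain ⟨h, hh, n, hn, rfl⟩ := hx
    obtain ⟨n, rfl⟩ := Nat.exists_eq_add_of_le' (show 1 ≤ n by omega)
    obtain ⟨k, hk, m, hm, rfl⟩ := hy
    obtain ⟨m, rfl⟩ := Nat.exists_eq_add_of_le' (show 1 ≤ m by omega)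
    obtain ⟨N, hN⟩ := exists_isHorizontal hS i
      (mem_leftCosetSet_of_mem hk hh (self_mem_leftCosetSet (P i) k))
    obtain ⟨q, hq, hqA⟩ := exists_geodesic_to_top hS i hk hh m (N := max N (max (n + 1) (m + 1)))
      (by omega) (Or.inr (hN.mono (le_max_left _ _)))
    obtain ⟨r, hr, hrA⟩ := exists_geodesic_to_top hS i hh hh n (N := max N (max (n + 1) (m + 1)))
      (by omega) (Or.inl rfl)
    obtain ⟨b, hb, hab⟩ := hδ _ _ _ p q r hp hq hr a ha
    have hbC : b ∈ horoballVertices P i g C := by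
      rcases hb with hb | hb
      · exact horoballVertices_anti hm (hqA b hb)
      · exact horoballVertices_anti hn (hrA b hb)
    rw [hG.edist_le_coe_iff] at hab
    obtain ⟨w, hw⟩ := hG.exists_walk_length_eq_dist b a
    rw [SimpleGraph.dist_comm] at hw
    exact mem_horoballVertices_of_walk w (horoballVertices_anti (by omega) hbC)
  -- The push fixes both endpoints and does not lengthen the geodesic, so the result is again
  -- geodesic.
  obtain ⟨q, hq, hqA⟩ := exists_pushUp_walk C p hp1
  refine ⟨q.copy (pushUp_eq_self (by omega) hx) (pushUp_eq_self (by omega) hy),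
    le_antisymm ?_ (SimpleGraph.dist_le _), ?_⟩
  · rw [SimpleGraph.Walk.length_copy]
    exact hq.trans hp.le
  · rwa [SimpleGraph.Walk.support_copy]

end Cusped

theorem mainTheorem5 {Γ : Type u} [Group Γ] {I : Type v} [Finite I] [Nonempty I]
    (P : I → Subgroup Γ) (S : Set Γ) (hS : IsCompatibleGeneratingSet P S)
    (δ : ℕ) (hδ : IsHyperbolicGraph (cuspedGraph P S) δ)
    (C : ℕ) (hC : δ < C) (κ : ℕ) (hκ : 4 * δ + 6 ≤ κ) :
    ContractibleSpace (SCRealization (ripsComplex (cuspedGraph P S) κ)) ∧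
    (∀ (i : I) (g : Γ), ContractibleSpace
      (SCRealization (fullSubcomplex (ripsComplex (cuspedGraph P S) κ)
        (horoballVertices P i g C)))) ∧
    (∀ (v : CuspedVertex Γ I) (r : ℕ), ContractibleSpace
      (SCRealization (complexBall (ripsComplex (cuspedGraph P S) κ) v r))) := by
  have hG := cuspedGraph_connected hS
  refine ⟨contractibleSpace_ripsComplex hδ hG (by omega) (by omega), fun i g => ?_, fun v r =>
    contractibleSpace_complexBall_ripsComplex hδ hG (by omega) (by omega) v r⟩
  have ho : CuspedVertex.triple g i C ∈ horoballVertices P i g C :=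
    ⟨g, self_mem_leftCosetSet _ g, C, le_rfl, rfl⟩
  exact contractibleSpace_ripsComplex_of_starShaped hδ hG (by omega) (by omega) _ _ ho
    fun v hv => exists_geodesic_in_horoball hS hδ hC i g ho hv
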